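/- Let $P$ be a partially ordered set. If $P$ is well-quasi-ordered (that is, well-founded and without infinite antichains) and the set $\mathcal{J}^{\neg\downarrow}(P)$ of non-principal ideals of $P$, ordered by inclusion, is better-quasi-ordered, then $P$ is better-quasi-ordered. Here an *ideal* of $P$ is a non-empty, downward closed, up-directed subset of $P$; it is *non-principal* if it is not of the form $\{y\in P : y\le x\}$ with $x\in P$. Identify each finite subset of $\mathbb{N}$ with the increasing list of its elements. A *barrier* is an infinite set $B$ of finite subsets of $\mathbb{N}$ such that every infinite $X\subseteq\bigcup B$ has a non-empty initial segment belonging to $B$, and no member of $B$ is properly contained in another one; its *order type* is its order type under the lexicographic order, by which every barrier is well-ordered. For finite $s,t\subseteq\mathbb{N}$ write $s\vartriangleleft t$ if there is a finite $r\subseteq\mathbb{N}$ such that $s$ is a proper initial segment of $r$ and $t$ is obtained from $r$ by deleting its least element. A poset $Q$ is *better-quasi-ordered* if, for every countable ordinal $\alpha$, every barrier $B$ of order type at most $\alpha$ and every map $f:B\to Q$, there are $s,t\in B$ with $s\vartriangleleft t$ and $f(s)\le f(t)$. -/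

import Mathlib

namespace BQO

/-- `s ≤_in X`: the finite set `s`, listed increasingly, is an initial segment of `X ⊆ ℕ`,
listed increasingly (`X` finite or infinite). -/
def IsInit (s : Finset ℕ) (X : Set ℕ) : Prop :=
  (↑s : Set ℕ) ⊆ X ∧ ∀ x ∈ X, ∀ y ∈ s, x ≤ y → x ∈ s

/-- `*s`: the set `s` with its least element deleted (`*∅ = ∅`). -/
def tail (s : Finset ℕ) : Finset ℕ :=
  s.filter fun n => ∃ m ∈ s, m < n

/-- `s ◁ t`: there is a finite `r` of which `s` is a proper initial segment with `t = *r`. -/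
def Shift (s t : Finset ℕ) : Prop :=
  ∃ r : Finset ℕ, IsInit s ↑r ∧ s ≠ r ∧ t = tail r

/-- The strict lexicographic order on finite sets of natural numbers, each one identified with
the increasing list of its elements. -/
def LexLT (s t : Finset ℕ) : Prop :=
  s.sort (· ≤ ·) < t.sort (· ≤ ·)

/-- The union `⋃ B` of a set `B` of finite sets of natural numbers. -/
def base (B : Set (Finset ℕ)) : Set ℕ :=
  {n | ∃ s ∈ B, n ∈ s}

/-- A block: an infinite set `B` of finite subsets of `ℕ` such that every infinite `X ⊆ ⋃ B` has a
non-empty initial segment in `B`. -/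
structure IsBlock (B : Set (Finset ℕ)) : Prop where
  infinite : B.Infinite
  exists_init : ∀ X : Set ℕ, X ⊆ base B → X.Infinite → ∃ s ∈ B, s ≠ ∅ ∧ IsInit s X

/-- A barrier: a block which is an antichain for inclusion. -/
structure IsBarrier (B : Set (Finset ℕ)) : Prop extends IsBlock B where
  antichain : IsAntichain (· ⊆ ·) B

/-- `B` is well-ordered by the lexicographic order, with order type at most `α`. -/
def LexTypeLE (B : Set (Finset ℕ)) (α : Ordinal.{0}) : Prop :=
  ∃ _ : IsWellOrder ↥B (fun s t => LexLT s.1 t.1),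
    Ordinal.type (fun s t : ↥B => LexLT s.1 t.1) ≤ α

/-- A map from a set of finite subsets of `ℕ` (in practice a barrier) into an order is good if
`f s ≤ f t` for some `s ◁ t`. -/
def IsGood {P : Type*} [LE P] {B : Set (Finset ℕ)} (f : ↥B → P) : Prop :=
  ∃ s t : ↥B, Shift s.1 t.1 ∧ f s ≤ f t

/-- `P` is `α`-better-quasi-ordered. -/
def IsAlphaBQO (α : Ordinal.{0}) (P : Type*) [LE P] : Prop :=
  ∀ B : Set (Finset ℕ), IsBarrier B → LexTypeLE B α → ∀ f : ↥B → P, IsGood f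

/-- `P` is better-quasi-ordered: it is `α`-better-quasi-ordered for every countable ordinal `α`. -/
def IsBQO (P : Type*) [LE P] : Prop :=
  ∀ α : Ordinal.{0}, α.card ≤ Cardinal.aleph0 → IsAlphaBQO α P

/-- The non-principal ideals of `P`, ordered by inclusion. -/
abbrev NonPrincipalIdeal (P : Type*) [PartialOrder P] : Type _ :=
  {I : Order.Ideal P // ∀ x : P, I ≠ Order.Ideal.principal x}

end BQO

namespace BQO

/-! ### Initial segments -/

/-! A map on a barrier `B` is viewed as a locally constant function `φ` on the infinite subsets of
`base B`. Since `B` is an antichain, the map is bad exactly when `φ X ≤ φ (tailSet X)` never holds.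

Assume this. Well-quasi-ordering gives monotone subsequences, and such a sequence either is
eventually constant or generates a non-principal ideal. Bar induction with diagonalisation
(`exists_constOn_or_hasLimit`) propagates this alternative: on some infinite `Y`, either `φ` is
constant, which contradicts badness, or every infinite `X ⊆ Y` has an initial segment `v` after
which the values of `φ` converge to a non-principal ideal as the next element grows. The shortest
such `v` lies inside the member of `B` that starts `X` (`HasLimit.subset_of_const`), so the limit
ideals form a map on a restriction of `B`. Ramsey's theorem also arranges that the shortest `v` for
`tailSet X` is never contained in the one for `X` (`exists_not_isFirst_subset`).

As the non-principal ideals are better-quasi-ordered, the limits along some `X` and `tailSet X`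
satisfy `I ≤ I'`. A value approximating `I` lies in `I'`, hence is below all late values
approximating `I'`. Changing `X` far out realises such a pair as `φ W ≤ φ (tailSet W)`, a
contradiction (`HasLimit.exists_le`). The bound on order types costs nothing, by
`IsBarrier.lexTypeLE`. -/

/-- `n` is larger than every element of `u`. -/
def Above (u : Finset ℕ) (n : ℕ) : Prop := ∀ x ∈ u, x < n

lemma IsInit.subset_total {s t : Finset ℕ} {X : Set ℕ} (hs : IsInit s X) (ht : IsInit t X) :
    s ⊆ t ∨ t ⊆ s := by
  by_contra! h
  obtain ⟨⟨x, hx, hxt⟩, y, hy, hys⟩ := And.imp Finset.not_subset.1 Finset.not_subset.1 h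
  rcases le_total x y with hxy | hxy
  · exact hxt (ht.2 x (hs.1 hx) y hy hxy)
  · exact hys (hs.2 y (ht.1 hy) x hx hxy)

lemma IsInit.of_subset {s : Finset ℕ} {X Y : Set ℕ} (hs : IsInit s X) (hY : Y ⊆ X)
    (hst : ↑s ⊆ Y) : IsInit s Y :=
  ⟨hst, fun x hx y hy h => hs.2 x (hY hx) y hy h⟩

lemma IsInit.trans {s t : Finset ℕ} {X : Set ℕ} (hs : IsInit s ↑t) (ht : IsInit t X) :
    IsInit s X :=
  ⟨fun _ hx => ht.1 (hs.1 hx), fun x hx y hy h =>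
    hs.2 x (ht.2 x hx y (hs.1 hy) h) y hy h⟩

lemma isInit_empty (X : Set ℕ) : IsInit ∅ X := by simp [IsInit]

lemma isInit_union {u : Finset ℕ} {Z : Set ℕ} (hZ : ∀ z ∈ Z, Above u z) :
    IsInit u (↑u ∪ Z) := by
  refine ⟨Set.subset_union_left, fun x hx y hy h => ?_⟩
  rcases hx with hx | hx
  · exact hx
  · exact absurd (hZ x hx y hy) (by omega)

lemma infinite_above {X : Set ℕ} (hX : X.Infinite) (u : Finset ℕ) :
    {x ∈ X | Above u x}.Infinite := by
  intro hf
  refine hX ((hf.union (Set.finite_Iic (u.sup id))).subset fun x hx => ?_)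
  by_cases h : Above u x
  · exact Or.inl ⟨hx, h⟩
  · simp only [Above, not_forall, not_lt] at h
    obtain ⟨y, hy, h⟩ := h
    exact Or.inr (h.trans (Finset.le_sup (f := id) hy))

lemma IsInit.exists_next {u : Finset ℕ} {X : Set ℕ} (hu : IsInit u X)
    (hne : ∃ x ∈ X, x ∉ u) :
    ∃ n ∈ X, Above u n ∧ IsInit (insert n u) X ∧ ∀ x ∈ X, Above u x → n ≤ x := by
  have habove : ∀ x ∈ X, x ∉ u → Above u x := fun x hx hxu y hy => by
    by_contra! h
    exact hxu (hu.2 x hx y hy h)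
  have hne' : {x ∈ X | Above u x}.Nonempty := by
    obtain ⟨x, hx, hxu⟩ := hne
    exact ⟨x, hx, habove x hx hxu⟩
  have hn := Nat.sInf_mem hne'
  have hle : ∀ x ∈ X, Above u x → sInf {x ∈ X | Above u x} ≤ x := fun x hx h =>
    Nat.sInf_le ⟨hx, h⟩
  refine ⟨_, hn.1, hn.2, ⟨?_, fun x hx y hy hxy => ?_⟩, hle⟩
  · rw [Finset.coe_insert]
    exact Set.insert_subset hn.1 hu.1
  · by_contra hxu
    rw [Finset.mem_insert, not_or] at hxu
    have := habove x hx hxu.2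
    rcases Finset.mem_insert.1 hy with rfl | hy
    · exact hxu.1 (hxy.antisymm (hle x hx this))
    · exact absurd (this y hy) (by omega)

lemma exists_isInit_superset {F : Finset ℕ} {X : Set ℕ} (hF : ↑F ⊆ X) :
    ∃ w : Finset ℕ, IsInit w X ∧ F ⊆ w := by
  have hf : {x ∈ X | ∃ y ∈ F, x ≤ y}.Finite :=
    (Set.finite_Iic (F.sup id)).subset fun x ⟨_, y, hy, h⟩ =>
      h.trans (Finset.le_sup (f := id) hy)
  refine ⟨hf.toFinset, ⟨fun x hx => ?_, fun x hx y hy h => ?_⟩, fun x hx => ?_⟩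
  · simp only [Set.Finite.coe_toFinset] at hx
    exact hx.1
  · simp only [Set.Finite.mem_toFinset, Set.mem_ofPred_eq] at hy ⊢
    obtain ⟨_, z, hz, hyz⟩ := hy
    exact ⟨hx, z, hz, h.trans hyz⟩
  · simp only [Set.Finite.mem_toFinset, Set.mem_ofPred_eq]
    exact ⟨hF hx, x, hx, le_rfl⟩

/-! ### Deleting the least element -/

/-- The set `X` with its least element deleted. -/
def tailSet (X : Set ℕ) : Set ℕ := {n ∈ X | ∃ m ∈ X, m < n}

lemma coe_tail (s : Finset ℕ) : (↑(tail s) : Set ℕ) = tailSet ↑s := by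
  ext n; simp [tail, tailSet]

lemma tailSet_subset (X : Set ℕ) : tailSet X ⊆ X := fun _ h => h.1

lemma insert_union_eq (n : ℕ) (u : Finset ℕ) (Z : Set ℕ) :
    (↑(insert n u) : Set ℕ) ∪ Z = insert n (↑u ∪ Z) := by
  rw [Finset.coe_insert, Set.insert_union]

lemma tailSet_insert {n : ℕ} {X : Set ℕ} (h : ∀ x ∈ X, n < x) : tailSet (insert n X) = X := by
  ext x
  simp only [tailSet, Set.mem_insert_iff, exists_eq_or_imp]
  constructor
  · rintro ⟨rfl | hx, hm | ⟨m, hm, hmx⟩⟩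
    · omega
    · exact absurd (h m hm) (by omega)
    · exact hx
    · exact hx
  · intro hx
    exact ⟨Or.inr hx, Or.inl (h x hx)⟩

lemma exists_eq_insert {X : Set ℕ} (hX : X.Nonempty) :
    ∃ n ∈ X, X = insert n (tailSet X) ∧ ∀ x ∈ tailSet X, n < x := by
  refine ⟨sInf X, Nat.sInf_mem hX, ?_, fun x ⟨_, m, hm, h⟩ => (Nat.sInf_le hm).trans_lt h⟩
  ext x
  constructor
  · intro hx
    rcases (Nat.sInf_le hx).eq_or_lt with h | h
    · exact Or.inl h.symm
    · exact Or.inr ⟨hx, _, Nat.sInf_mem hX, h⟩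
  · rintro (rfl | hx)
    · exact Nat.sInf_mem hX
    · exact hx.1

/-- A long enough initial segment `w` of `X` also determines the beginning of `tailSet X`; this
makes colourings that mention both sets locally constant. -/
lemma IsInit.tailSet_congr {u w : Finset ℕ} {X X' : Set ℕ} (hu : IsInit u (tailSet X))
    (hw : IsInit w X) (hw' : IsInit w X') (huw : u ⊆ w) : IsInit u (tailSet X') := by
  refine ⟨fun x hx => ?_, fun x hx y hy hxy => ?_⟩
  · obtain ⟨_, m, hm, hmx⟩ := hu.1 hx
    exact ⟨hw'.1 (huw hx), m, hw'.1 (hw.2 m hm x (huw hx) hmx.le), hmx⟩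
  · obtain ⟨hx, m, hm, hmx⟩ := hx
    have hxw := hw'.2 x hx y (huw hy) hxy
    exact hu.2 x ⟨hw.1 hxw, m, hw.1 (hw'.2 m hm x hxw hmx.le), hmx⟩ y hy hxy

lemma infinite_tailSet {X : Set ℕ} (hX : X.Infinite) : (tailSet X).Infinite := by
  obtain ⟨n, _, h, _⟩ := exists_eq_insert hX.nonempty
  intro hf
  exact hX (h ▸ hf.insert n)

/-- Initial segments of `X` and of `X` without its least element are related by `Shift`. -/
lemma IsInit.shift {s t : Finset ℕ} {X : Set ℕ} (hX : X.Infinite) (hs : IsInit s X)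
    (ht : IsInit t (tailSet X)) (h : ¬ t ⊂ s) : Shift s t := by
  obtain ⟨n, hn, hXn, hlt⟩ := exists_eq_insert hX.nonempty
  have hr : IsInit (insert n t) X := by
    refine ⟨?_, fun x hx y hy hxy => ?_⟩
    · rw [Finset.coe_insert]
      exact Set.insert_subset hn (ht.1.trans (tailSet_subset X))
    · rw [hXn] at hx
      rcases hx with rfl | hx
      · simp
      · rcases Finset.mem_insert.1 hy with rfl | hy
        · exact absurd (hlt x hx) (by omega)
        · exact Finset.mem_insert_of_mem (ht.2 x hx y hy hxy)
  have hnt : n ∉ t := fun hn' => absurd (hlt n (ht.1 hn')) (lt_irrefl _)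
  have htl : t = tail (insert n t) := by
    apply Finset.coe_injective
    rw [coe_tail, Finset.coe_insert, tailSet_insert fun x hx => hlt x (ht.1 hx)]
  -- Otherwise `t`, which lacks the minimum `n`, would be properly contained in `s`.
  have key : ¬ insert n t ⊆ s := by
    intro hsub
    exact h ((Finset.ssubset_insert hnt).trans_subset hsub)
  refine ⟨insert n t, ?_, fun h => key (h ▸ le_rfl), htl⟩
  exact hs.of_subset (Y := ↑(insert n t)) hr.1 (by exact_mod_cast (hs.subset_total hr).resolve_right key)

/-- Conversely, `Shift s t` lets `s` and `t` be continued to initial segments of an infinite set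
and of this set without its least element. -/
lemma Shift.exists_isInit {s t : Finset ℕ} (h : Shift s t) (ht : t.Nonempty) {Z : Set ℕ}
    (hZ : ∀ z ∈ Z, Above t z) :
    ∃ n, (∀ x ∈ t, n < x) ∧ (∀ z ∈ Z, n < z) ∧ s ⊆ insert n t ∧
      IsInit s (insert n (↑t ∪ Z)) := by
  obtain ⟨r, hs, _, rfl⟩ := h
  have hr : r.Nonempty := ht.mono (Finset.filter_subset _ _)
  obtain ⟨n, hn, hrn, hlt⟩ := exists_eq_insert (X := ↑r) (by exact_mod_cast hr)
  rw [← coe_tail] at hrn hlt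
  have hrn' : r = insert n (tail r) := Finset.coe_injective (by rw [hrn]; simp [← hrn])
  have hZn : ∀ z ∈ Z, n < z := fun z hz => by
    obtain ⟨x, hx⟩ := ht
    exact (hlt x hx).trans (hZ z hz x hx)
  refine ⟨n, hlt, hZn, ?_, ?_⟩
  · rw [← hrn']
    exact_mod_cast hs.1
  · rw [← insert_union_eq, ← hrn']
    refine hs.trans (isInit_union fun z hz x hx => ?_)
    rw [hrn'] at hx
    rcases Finset.mem_insert.1 hx with rfl | hx
    · exact hZn z hz
    · exact hZ z hz x hx

/-! ### Bar induction -/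

/-- If `∅` were not good, `hstep` would allow larger and larger elements to be appended forever
without reaching a good set; the infinite union would then avoid the bar. -/
lemma bar_induction {A : Set ℕ} {good : Finset ℕ → Prop}
    (hbar : ∀ X ⊆ A, X.Infinite → ∃ u, IsInit u X ∧ good u)
    (hstep : ∀ u : Finset ℕ, ↑u ⊆ A → (∀ n ∈ A, Above u n → good (insert n u)) → good u) :
    good ∅ := by
  by_contra h0
  have hnext : ∀ u : {u : Finset ℕ // ↑u ⊆ A ∧ ¬ good u},
      ∃ n ∈ A, Above u.1 n ∧ ¬ good (insert n u.1) := by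
    intro u
    by_contra! h
    exact u.2.2 (hstep u.1 u.2.1 h)
  choose n hnA hnu hng using hnext
  let w : ℕ → {u : Finset ℕ // ↑u ⊆ A ∧ ¬ good u} := fun k =>
    Nat.rec ⟨∅, by simp, h0⟩ (fun _ u => ⟨insert (n u) u.1, by
      rw [Finset.coe_insert]; exact Set.insert_subset (hnA u) u.2.1, hng u⟩) k
  have hw : ∀ k, (w (k + 1)).1 = insert (n (w k)) (w k).1 := fun _ => rfl
  have hinit : ∀ k d, IsInit (w k).1 ↑(w (k + d)).1 := by
    intro k d
    induction d with
    | zero => exact ⟨subset_rfl, fun x hx _ _ _ => hx⟩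
    | succ d ih =>
      refine ih.trans ?_
      rw [← add_assoc, hw, Finset.coe_insert, Set.insert_eq, Set.union_comm]
      exact isInit_union (by rintro z rfl; exact hnu _)
  have hcard : ∀ k, (w k).1.card = k := by
    intro k
    induction k with
    | zero => rfl
    | succ k ih =>
      rw [hw, Finset.card_insert_of_notMem fun h => lt_irrefl _ (hnu _ _ h), ih]
  have hX : ∀ k, IsInit (w k).1 {x | ∃ j, x ∈ (w j).1} := by
    refine fun k => ⟨fun x hx => ⟨k, hx⟩, ?_⟩
    rintro x ⟨j, hj⟩ y hy hxy
    rcases le_total k j with h | h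
    · obtain ⟨d, rfl⟩ := Nat.exists_eq_add_of_le h
      exact (hinit k d).2 x hj y hy hxy
    · obtain ⟨d, rfl⟩ := Nat.exists_eq_add_of_le h
      exact (hinit j d).1 hj
  have hinf : {x | ∃ j, x ∈ (w j).1}.Infinite := by
    intro hf
    have : (w (hf.toFinset.card + 1)).1 ⊆ hf.toFinset := fun x hx => by
      rw [Set.Finite.mem_toFinset]
      exact ⟨hf.toFinset.card + 1, hx⟩
    have := Finset.card_le_card this
    have := hcard (hf.toFinset.card + 1)
    omega
  obtain ⟨u, hu, hgu⟩ := hbar _ (by rintro x ⟨j, hj⟩; exact (w j).2.1 hj) hinf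
  -- Initial segments of one set are nested, hence determined by their cardinality.
  have : u = (w u.card).1 := by
    rcases hu.subset_total (hX u.card) with h | h
    · exact Finset.eq_of_subset_of_card_le h (by rw [hcard])
    · exact (Finset.eq_of_subset_of_card_le h (by rw [hcard])).symm
  exact (w u.card).2.2 (this ▸ hgu)

/-- Bar induction for properties that are only obtained after passing to an infinite subset. -/
lemma exists_infinite_subset_of_bar {A : Set ℕ} (hA : A.Infinite) {Q : Finset ℕ → Set ℕ → Prop}
    (hmono : ∀ u Y Y', Q u Y → (∀ y ∈ Y', Above u y → y ∈ Y) → Q u Y')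
    (hbar : ∀ X ⊆ A, X.Infinite → ∃ u, IsInit u X ∧ Q u A)
    (hstep : ∀ u, ∀ Y ⊆ A, Y.Infinite → (∀ n ∈ Y, Above u n) →
      (∀ n ∈ Y, Q (insert n u) Y) → ∃ Y' ⊆ Y, Y'.Infinite ∧ Q u Y') :
    ∃ Y ⊆ A, Y.Infinite ∧ Q ∅ Y := by
  -- Quantifying over all infinite `X ⊆ A` lets the induction hypothesis be applied again inside
  -- sets that were already thinned out.
  suffices h : ∀ X ⊆ A, X.Infinite → ∃ Y ⊆ X, Y.Infinite ∧ Q ∅ Y from h A subset_rfl hA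
  refine bar_induction (A := A)
    (good := fun u => ∀ X ⊆ A, X.Infinite → ∃ Y ⊆ X, Y.Infinite ∧ Q u Y) ?_ ?_
  · intro X hXA hX
    obtain ⟨u, hu, hQ⟩ := hbar X hXA hX
    exact ⟨u, hu, fun X' hX' hi => ⟨X', subset_rfl, hi, hmono _ _ _ hQ fun y hy _ => hX' hy⟩⟩
  · intro u _ hgood X hXA hX
    have hnext : ∀ Y : {Y : Set ℕ // Y ⊆ A ∧ Y.Infinite ∧ ∀ n ∈ Y, Above u n},
        ∃ Y' : {Y : Set ℕ // Y ⊆ A ∧ Y.Infinite ∧ ∀ n ∈ Y, Above u n},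
          Y'.1 ⊆ tailSet Y.1 ∧ Q (insert (sInf Y.1) u) Y'.1 := by
      rintro ⟨Y, hYA, hY, hYu⟩
      have hm := Nat.sInf_mem hY.nonempty
      obtain ⟨Y', hY', hi, hQ⟩ := hgood _ (hYA hm) (hYu _ hm) (tailSet Y)
        ((tailSet_subset Y).trans hYA) (infinite_tailSet hY)
      exact ⟨⟨Y', fun x hx => hYA (hY' hx).1, hi, fun x hx => hYu _ (hY' hx).1⟩, hY', hQ⟩
    choose next hnext hQ using hnext
    -- Diagonalisation: each step sets aside the minimum of the current set and thins out the rest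
    -- to obtain `Q` for that minimum. The set of these minima is what `hstep` receives.
    let W : ℕ → {Y : Set ℕ // Y ⊆ A ∧ Y.Infinite ∧ ∀ n ∈ Y, Above u n} := fun k =>
      next^[k] ⟨{x ∈ X | Above u x}, fun x hx => hXA hx.1, infinite_above hX u, fun x hx => hx.2⟩
    have hW : ∀ k, W (k + 1) = next (W k) := fun k => Function.iterate_succ_apply' _ _ _
    have hWmem : ∀ k, sInf (W k).1 ∈ (W k).1 := fun k => Nat.sInf_mem (W k).2.2.1.nonempty
    have hWanti : Antitone fun k => (W k).1 := antitone_nat_of_succ_le fun k x hx => by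
      rw [hW] at hx
      exact (hnext _ hx).1
    have hlt : StrictMono fun k => sInf (W k).1 := strictMono_nat_of_lt_succ fun k => by
      have := hWmem (k + 1)
      rw [hW] at this
      obtain ⟨_, m, hm, h⟩ := hnext _ this
      rw [hW]
      exact (Nat.sInf_le hm).trans_lt h
    obtain ⟨Y', hY', hi, hQ'⟩ := hstep u (Set.range fun k => sInf (W k).1)
      (by rintro _ ⟨k, rfl⟩; exact (W k).2.1 (hWmem k))
      (Set.infinite_range_of_injective hlt.injective)
      (by rintro _ ⟨k, rfl⟩; exact (W k).2.2.2 _ (hWmem k))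
      (by
        rintro _ ⟨k, rfl⟩
        refine hmono _ _ _ (hQ (W k)) ?_
        rintro _ ⟨j, rfl⟩ hj
        have hkj : k < j := hlt.lt_iff_lt.1 (hj _ (Finset.mem_insert_self _ _))
        rw [← hW]
        exact hWanti (Nat.succ_le_of_lt hkj) (hWmem j))
    refine ⟨Y', hY'.trans ?_, hi, hQ'⟩
    rintro _ ⟨k, rfl⟩
    exact (hWanti (Nat.zero_le k) (hWmem k)).1

/-! ### Barriers are well-ordered by the lexicographic order -/

lemma IsInit.sort_eq_append {u s : Finset ℕ} (hu : IsInit u ↑s) :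
    s.sort (· ≤ ·) = u.sort (· ≤ ·) ++ (s \ u).sort (· ≤ ·) := by
  have hus : u ⊆ s := by exact_mod_cast hu.1
  refine List.Perm.eq_of_pairwise (le := (· ≤ ·)) (fun a b _ _ => le_antisymm)
    (Finset.pairwise_sort _ _) ?_ ?_
  · refine List.pairwise_append.2 ⟨Finset.pairwise_sort _ _, Finset.pairwise_sort _ _, ?_⟩
    intro a ha b hb
    rw [Finset.mem_sort] at ha hb
    rw [Finset.mem_sdiff] at hb
    by_contra! h
    exact hb.2 (hu.2 b hb.1 a ha h.le)
  · refine (List.perm_ext_iff_of_nodup (Finset.sort_nodup _ _) ?_).2 fun a => ?_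
    · refine (Finset.sort_nodup _ _).append (Finset.sort_nodup _ _) fun a ha hb => ?_
      rw [Finset.mem_sort] at ha hb
      exact (Finset.mem_sdiff.1 hb).2 ha
    · simp only [Finset.mem_sort, List.mem_append, Finset.mem_sdiff]
      have := @hus a
      tauto

lemma sort_insert_of_above {u : Finset ℕ} {n : ℕ} (h : Above u n) :
    (insert n u).sort (· ≤ ·) = u.sort (· ≤ ·) ++ [n] := by
  have hnu : n ∉ u := fun hn => lt_irrefl _ (h n hn)
  have hu : IsInit u ↑(insert n u) := by
    rw [Finset.coe_insert, Set.insert_eq, Set.union_comm]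
    exact isInit_union (by rintro z rfl; exact h)
  rw [hu.sort_eq_append]
  congr 1
  rw [Finset.insert_sdiff_of_notMem _ hnu, Finset.sdiff_self, insert_empty_eq,
    Finset.sort_singleton]

lemma lexLT_of_isInit {u s t : Finset ℕ} {n k : ℕ} (hn : Above u n) (hk : Above u k)
    (hnk : n < k) (hs : IsInit (insert n u) ↑s) (ht : IsInit (insert k u) ↑t) :
    LexLT s t := by
  unfold LexLT
  rw [hs.sort_eq_append, ht.sort_eq_append, sort_insert_of_above hn, sort_insert_of_above hk,
    List.append_assoc, List.append_assoc]
  exact List.append_left_lt (List.cons_lt_cons_iff.2 (Or.inl hnk))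

lemma IsBarrier.eq_of_isInit {B : Set (Finset ℕ)} (hB : IsBarrier B) {s t : Finset ℕ}
    (hs : s ∈ B) (ht : t ∈ B) {X : Set ℕ} (hsX : IsInit s X) (htX : IsInit t X) : s = t := by
  rcases hsX.subset_total htX with h | h
  · exact hB.antichain.eq hs ht h
  · exact (hB.antichain.eq ht hs h).symm

/-- Bar induction on a common initial segment `u` of the family. If `u` belongs to the barrier, the
antichain property leaves only `u`; otherwise the minimum is sought among the members whose next
element after `u` is least. -/
lemma IsBarrier.exists_min {B : Set (Finset ℕ)} (hB : IsBarrier B) :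
    ∀ S ⊆ B, S.Nonempty → ∃ m ∈ S, ∀ s ∈ S, ¬ LexLT s m := by
  have hsingle : ∀ S ⊆ B, ∀ u ∈ S, (∀ s ∈ S, IsInit u ↑s) → ∃ m ∈ S, ∀ s ∈ S, ¬ LexLT s m := by
    refine fun S hS u hu h => ⟨u, hu, fun s hs => ?_⟩
    rw [hB.antichain.eq (hS hu) (hS hs) (by exact_mod_cast (h s hs).1)]
    exact lt_irrefl _
  suffices h : ∀ S ⊆ B, S.Nonempty → (∀ s ∈ S, IsInit ∅ ↑s) → ∃ m ∈ S, ∀ s ∈ S, ¬ LexLT s m from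
    fun S hS hne => h S hS hne fun s _ => isInit_empty _
  refine bar_induction (A := base B) (good := fun u => ∀ S ⊆ B, S.Nonempty →
    (∀ s ∈ S, IsInit u ↑s) → ∃ m ∈ S, ∀ s ∈ S, ¬ LexLT s m) ?_ ?_
  · intro X hX hi
    obtain ⟨u, hu, _, huX⟩ := hB.exists_init X hX hi
    refine ⟨u, huX, fun S hS hne h => ?_⟩
    obtain ⟨s, hs⟩ := hne
    obtain rfl := hB.antichain.eq hu (hS hs) (by exact_mod_cast (h s hs).1)
    exact hsingle S hS u hs h
  · intro u _ hgood S hS hne h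
    by_cases huS : u ∈ S
    · exact hsingle S hS u huS h
    have hnext : ∀ s ∈ S, ∃ n ∈ s, Above u n ∧ IsInit (insert n u) ↑s := by
      intro s hs
      have hus : u ⊂ s := Finset.ssubset_iff_subset_ne.2
        ⟨by exact_mod_cast (h s hs).1, fun e => huS (e ▸ hs)⟩
      obtain ⟨x, hx, hxu⟩ := Finset.exists_of_ssubset hus
      obtain ⟨n, hn, hun, hi, _⟩ := (h s hs).exists_next ⟨x, hx, hxu⟩
      exact ⟨n, hn, hun, hi⟩
    have hK : {n | ∃ s ∈ S, n ∈ s ∧ Above u n ∧ IsInit (insert n u) ↑s}.Nonempty := by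
      obtain ⟨s, hs⟩ := hne
      obtain ⟨n, hn⟩ := hnext s hs
      exact ⟨n, s, hs, hn⟩
    obtain ⟨n, hmem, hle⟩ : ∃ n, n ∈ _ ∧ ∀ k ∈ _, n ≤ k :=
      ⟨_, Nat.sInf_mem hK, fun _ hk => Nat.sInf_le hk⟩
    obtain ⟨s, hs, hns, hun, hi⟩ := hmem
    obtain ⟨m, ⟨hmS, hm⟩, hmin⟩ := hgood n ⟨s, hS hs, hns⟩ hun
      {s ∈ S | IsInit (insert n u) ↑s} (fun s hs => hS hs.1) ⟨s, hs, hi⟩ fun s hs => hs.2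
    refine ⟨m, hmS, fun t ht => ?_⟩
    obtain ⟨k, hkt, huk, hti⟩ := hnext t ht
    rcases (hle k ⟨t, ht, hkt, huk, hti⟩).eq_or_lt with rfl | hnk
    · exact hmin t ⟨ht, hti⟩
    · exact lt_asymm (lexLT_of_isInit hun huk hnk hm hti)

/-- There are only countably many finite sets of naturals, so the well-order has countable type and
the bound in `IsAlphaBQO` excludes no barrier. -/
lemma IsBarrier.lexTypeLE {B : Set (Finset ℕ)} (hB : IsBarrier B) :
    ∃ α : Ordinal.{0}, α.card ≤ Cardinal.aleph0 ∧ LexTypeLE B α := by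
  have : IsWellOrder ↥B fun s t => LexLT s.1 t.1 :=
    { wf := WellFounded.wellFounded_iff_has_min.2 fun S hS => by
        obtain ⟨_, ⟨m, hm, rfl⟩, hmin⟩ := hB.exists_min (Subtype.val '' S)
          (by rintro _ ⟨s, _, rfl⟩; exact s.2) (hS.image _)
        exact ⟨m, hm, fun s hs => hmin _ ⟨s, hs, rfl⟩⟩
      trichotomous := fun s t hst hts => by
        have h := le_antisymm (not_lt.1 hts) (not_lt.1 hst)
        apply Subtype.ext
        rw [← Finset.sort_toFinset s.1 (· ≤ ·), h, Finset.sort_toFinset] }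
  exact ⟨_, by rw [Ordinal.card_type]; exact Cardinal.mk_le_aleph0, this, le_rfl⟩

/-! ### Locally constant functions on infinite sets -/

/-- `φ` takes the value `c` at all infinite sets that consist of `u`, followed by elements
of `Y`. -/
def ConstOn {α : Type*} (φ : Set ℕ → α) (u : Finset ℕ) (Y : Set ℕ) (c : α) : Prop :=
  ∀ X : Set ℕ, X.Infinite → IsInit u X → (∀ x ∈ X, Above u x → x ∈ Y) → φ X = c

lemma ConstOn.mono {α : Type*} {φ : Set ℕ → α} {u : Finset ℕ} {Y Y' : Set ℕ} {c : α}
    (h : ConstOn φ u Y c) (hY : ∀ y ∈ Y', Above u y → y ∈ Y) : ConstOn φ u Y' c :=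
  fun X hX hu hXY => h X hX hu fun x hx hux => hY x (hXY x hx hux) hux

lemma Above.of_insert {u : Finset ℕ} {n x : ℕ} (h : Above (insert n u) x) : Above u x :=
  fun y hy => h y (Finset.mem_insert_of_mem hy)

lemma exists_next_of_infinite {u : Finset ℕ} {X : Set ℕ} (hX : X.Infinite) (hu : IsInit u X) :
    ∃ n ∈ X, Above u n ∧ IsInit (insert n u) X ∧ ∀ x ∈ X, Above u x → n ≤ x :=
  hu.exists_next ((hX.exists_notMem_finset u).imp fun _ h => h)

lemma constOn_of_insert {α : Type*} {φ : Set ℕ → α} {u : Finset ℕ} {Y : Set ℕ} {c : α}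
    (h : ∀ n ∈ Y, ConstOn φ (insert n u) Y c) : ConstOn φ u Y c := by
  intro X hX hu hXY
  obtain ⟨n, hn, hun, hi, _⟩ := exists_next_of_infinite hX hu
  exact h n (hXY n hn hun) X hX hi fun x hx hx' => hXY x hx hx'.of_insert

/-- Ramsey's theorem for locally constant colourings of infinite sets with two colours. -/
lemma exists_homogeneous {A : Set ℕ} (hA : A.Infinite) {C : Set ℕ → Prop}
    (hC : ∀ X ⊆ A, X.Infinite → ∃ u c, IsInit u X ∧ ConstOn C u A c) :
    ∃ Z ⊆ A, Z.Infinite ∧ ∃ c : Prop, ∀ X ⊆ Z, X.Infinite → (C X ↔ c) := by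
  obtain ⟨Z, hZA, hZ, c, hc⟩ := exists_infinite_subset_of_bar hA
    (Q := fun u Y => ∃ c, ConstOn C u Y c) (fun u Y Y' ⟨c, hc⟩ h => ⟨c, hc.mono h⟩)
    (fun X hXA hX => by
      obtain ⟨u, c, hu, hc⟩ := hC X hXA hX
      exact ⟨u, hu, c, hc⟩)
    (fun u Y _ hY _ h => by
      choose! c hc using h
      have key : ∀ (p : Prop) (Y' : Set ℕ), Y' ⊆ Y → (∀ n ∈ Y', c n = p) → ConstOn C u Y' p :=
        fun p Y' hY' hp => constOn_of_insert fun n hn =>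
          hp n hn ▸ (hc n (hY' hn)).mono fun y hy _ => hY' hy
      -- Pigeonhole: one of the two colours `c n` occurs for infinitely many `n ∈ Y`.
      rw [← Set.inter_union_compl Y {n | c n}, Set.infinite_union] at hY
      rcases hY with hY | hY
      · exact ⟨_, fun x hx => hx.1, hY, True, key _ _ (fun x hx => hx.1)
          fun n hn => eq_true hn.2⟩
      · exact ⟨_, fun x hx => hx.1, hY, False, key _ _ (fun x hx => hx.1)
          fun n hn => eq_false hn.2⟩)
  exact ⟨Z, hZA, hZ, c, fun X hX hi => iff_of_eq (hc X hi (isInit_empty X) fun x hx _ => hX hx)⟩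

/-! ### Limits in the space of ideals -/

variable {P : Type*} [PartialOrder P]

/-- After `v`, the value of `φ` at a subset of `Y` is determined by the next element, and these
values lie in the ideal `I` and tend to it. -/
def HasLimit (φ : Set ℕ → P) (v : Finset ℕ) (Y : Set ℕ) (I : Order.Ideal P) : Prop :=
  ∃ p : ℕ → P, (∀ n ∈ Y, Above v n → ConstOn φ (insert n v) Y (p n) ∧ p n ∈ I) ∧
    ∀ q ∈ I, ∃ N, ∀ n ∈ Y, N < n → Above v n → q ≤ p n

lemma HasLimit.mono {φ : Set ℕ → P} {v : Finset ℕ} {Y Y' : Set ℕ} {I : Order.Ideal P}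
    (h : HasLimit φ v Y I) (hY : ∀ y ∈ Y', Above v y → y ∈ Y) : HasLimit φ v Y' I := by
  obtain ⟨p, hp, hq⟩ := h
  refine ⟨p, fun n hn hv => ⟨(hp n (hY n hn hv) hv).1.mono fun y hy hy' =>
    hY y hy hy'.of_insert, (hp n (hY n hn hv) hv).2⟩, fun q hqI => ?_⟩
  obtain ⟨N, hN⟩ := hq q hqI
  exact ⟨N, fun n hn hNn hv => hN n (hY n hn hv) hNn hv⟩

/-- The ideal generated by the values of a monotone sequence. -/
def idealOfMonotone (a : ℕ → P) (ha : Monotone a) : Order.Ideal P where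
  carrier := {q | ∃ i, q ≤ a i}
  lower' := fun _ _ hba ⟨i, hi⟩ => ⟨i, hba.trans hi⟩
  nonempty' := ⟨a 0, 0, le_rfl⟩
  directed' := by
    rintro x ⟨i, hi⟩ y ⟨j, hj⟩
    exact ⟨a (max i j), ⟨_, le_rfl⟩, hi.trans (ha (le_max_left i j)),
      hj.trans (ha (le_max_right i j))⟩

/-- A monotone subsequence of the values `p n` generates an ideal. If that ideal is principal, its
generator is attained and the sequence is constant from there on; if not, the ideal is the limit. -/
lemma constOn_or_hasLimit_of_insert [WellQuasiOrderedLE P] {φ : Set ℕ → P} {u : Finset ℕ}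
    {Y : Set ℕ} (hY : Y.Infinite) (h : ∀ n ∈ Y, ∃ p, ConstOn φ (insert n u) Y p) :
    ∃ Y' ⊆ Y, Y'.Infinite ∧
      ((∃ p, ConstOn φ u Y' p) ∨ ∃ I : NonPrincipalIdeal P, HasLimit φ u Y' I.1) := by
  classical
  have : Nonempty P := ⟨(h _ hY.nonempty.some_mem).choose⟩
  choose! p hp using h
  have := hY.to_subtype
  let e := Nat.orderEmbeddingOfSet Y
  have he : ∀ i, e i ∈ Y := fun i => Nat.orderEmbeddingOfSet_range Y ▸ Set.mem_range_self i
  obtain ⟨g, hg⟩ := wellQuasiOrdered_le.exists_monotone_subseq fun i => p (e i)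
  have hmono : Monotone fun i => p (e (g i)) := fun i j hij => hg i j hij
  have hsm : StrictMono fun i => e (g i) := e.strictMono.comp g.strictMono
  by_cases hI : ∃ x, idealOfMonotone _ hmono = Order.Ideal.principal x
  · obtain ⟨x, hx⟩ := hI
    have hle : ∀ i, p (e (g i)) ≤ x := fun i => by
      rw [← Order.Ideal.mem_principal, ← hx]
      exact ⟨i, le_rfl⟩
    obtain ⟨i, hi⟩ : x ∈ idealOfMonotone _ hmono := by
      rw [hx]
      exact Order.Ideal.mem_principal.2 le_rfl
    refine ⟨Set.range fun j => e (g (i + j)), ?_, ?_, Or.inl ⟨x, constOn_of_insert ?_⟩⟩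
    · rintro _ ⟨j, rfl⟩
      exact he _
    · exact Set.infinite_range_of_injective (hsm.injective.comp (add_right_injective i))
    · rintro _ ⟨j, rfl⟩
      rw [← (hle (i + j)).antisymm (hi.trans (hmono (Nat.le_add_right i j)))]
      refine (hp _ (he _)).mono ?_
      rintro _ ⟨k, rfl⟩ _
      exact he _
  · push Not at hI
    refine ⟨Set.range fun j => e (g j), ?_, Set.infinite_range_of_injective hsm.injective,
      Or.inr ⟨⟨_, hI⟩, p, ?_, ?_⟩⟩
    · rintro _ ⟨j, rfl⟩
      exact he _
    · rintro _ ⟨j, rfl⟩ _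
      refine ⟨(hp _ (he _)).mono ?_, j, le_rfl⟩
      rintro _ ⟨k, rfl⟩ _
      exact he _
    · rintro q ⟨i, hi⟩
      refine ⟨e (g i), ?_⟩
      rintro _ ⟨j, rfl⟩ hij _
      exact hi.trans (hmono (hsm.lt_iff_lt.1 hij).le)

/-- A locally constant function into a well-quasi-order is, on a suitable set, constant or
approximates non-principal ideals along a front. -/
lemma exists_constOn_or_hasLimit [WellQuasiOrderedLE P] {A : Set ℕ} (hA : A.Infinite)
    {φ : Set ℕ → P} (hφ : ∀ X ⊆ A, X.Infinite → ∃ u c, IsInit u X ∧ ConstOn φ u A c) :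
    ∃ Y ⊆ A, Y.Infinite ∧ ((∃ c, ConstOn φ ∅ Y c) ∨ ∀ X ⊆ Y, X.Infinite →
      ∃ v, IsInit v X ∧ ∃ I : NonPrincipalIdeal P, HasLimit φ v Y I.1) := by
  have hmonoR : ∀ (u : Finset ℕ) (Y Y' : Set ℕ),
      (∀ X : Set ℕ, X.Infinite → IsInit u X → (∀ x ∈ X, Above u x → x ∈ Y) →
        ∃ v, u ⊆ v ∧ IsInit v X ∧ ∃ I : NonPrincipalIdeal P, HasLimit φ v Y I.1) →
      (∀ y ∈ Y', Above u y → y ∈ Y) →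
      (∀ X : Set ℕ, X.Infinite → IsInit u X → (∀ x ∈ X, Above u x → x ∈ Y') →
        ∃ v, u ⊆ v ∧ IsInit v X ∧ ∃ I : NonPrincipalIdeal P, HasLimit φ v Y' I.1) := by
    intro u Y Y' h hY X hX hu hXY
    obtain ⟨v, huv, hv, I, hI⟩ := h X hX hu fun x hx hux => hY x (hXY x hx hux) hux
    exact ⟨v, huv, hv, I, hI.mono fun y hy hvy => hY y hy fun x hx => hvy x (huv hx)⟩
  -- The extra condition `u ⊆ v` makes the second alternative survive thinning: `Y` is controlled
  -- only above `u`, and being above `v` must imply this.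
  obtain ⟨Y, hYA, hY, h⟩ := exists_infinite_subset_of_bar hA
    (Q := fun u Y => (∃ c, ConstOn φ u Y c) ∨
      ∀ X : Set ℕ, X.Infinite → IsInit u X → (∀ x ∈ X, Above u x → x ∈ Y) →
        ∃ v, u ⊆ v ∧ IsInit v X ∧ ∃ I : NonPrincipalIdeal P, HasLimit φ v Y I.1)
    (fun u Y Y' h hY => h.imp (fun ⟨c, hc⟩ => ⟨c, hc.mono hY⟩) fun h => hmonoR u Y Y' h hY)
    (fun X hXA hX => by
      obtain ⟨u, c, hu, hc⟩ := hφ X hXA hX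
      exact ⟨u, hu, Or.inl ⟨c, hc⟩⟩)
    (fun u Y _ hY hYu h => by
      have hY' := hY
      rw [← Set.inter_union_compl Y {n | ∃ c, ConstOn φ (insert n u) Y c},
        Set.infinite_union] at hY'
      -- If the constant case occurs for infinitely many next elements, these constants have a
      -- constant or limiting subsequence; otherwise infinitely many next elements already have
      -- limits further on.
      rcases hY' with hY' | hY'
      · obtain ⟨Y', hY'Y, hi, h'⟩ := constOn_or_hasLimit_of_insert hY'
          fun n ⟨_, c, hc⟩ => ⟨c, hc.mono fun y hy _ => hy.1⟩
        refine ⟨Y', fun x hx => (hY'Y hx).1, hi, h'.imp id ?_⟩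
        rintro ⟨I, hI⟩ X _ hu _
        exact ⟨u, subset_rfl, hu, I, hI⟩
      · refine ⟨_, fun x hx => hx.1, hY', Or.inr fun X hX hu hXY => ?_⟩
        obtain ⟨n, hn, hun, hi, _⟩ := exists_next_of_infinite hX hu
        obtain ⟨hnY, hn'⟩ := hXY n hn hun
        obtain ⟨v, hv, hr⟩ := hmonoR _ _ _ ((h n hnY).resolve_left hn')
          (fun y hy _ => hy.1) X hX hi (fun x hx hx' => hXY x hx hx'.of_insert)
        exact ⟨v, (Finset.subset_insert n u).trans hv, hr⟩)
  refine ⟨Y, hYA, hY, h.imp id fun h X hX hi => ?_⟩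
  obtain ⟨v, _, hv⟩ := h X hi (isInit_empty X) fun x hx _ => hX hx
  exact ⟨v, hv⟩

lemma HasLimit.exists_eq {φ : Set ℕ → P} {v : Finset ℕ} {Y : Set ℕ} {I : Order.Ideal P}
    (h : HasLimit φ v Y I) : ∃ p : ℕ → P,
      (∀ n ∈ Y, Above v n → p n ∈ I) ∧
      (∀ X ⊆ Y, X.Infinite → ∀ n, Above v n → IsInit (insert n v) X → φ X = p n) ∧
      ∀ q ∈ I, ∃ N, ∀ n ∈ Y, N < n → Above v n → q ≤ p n := by
  obtain ⟨p, hp, hq⟩ := h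
  exact ⟨p, fun n hn hv => (hp n hn hv).2, fun X hX hi n hv hn =>
    (hp n (hX (hn.1 (by simp))) hv).1 X hi hn fun x hx _ => hX hx, hq⟩

/-! ### Shortest initial segments -/

/-- `v` is the shortest initial segment of `X` that belongs to `G`. -/
structure IsFirst (G : Finset ℕ → Prop) (v : Finset ℕ) (X : Set ℕ) : Prop where
  prop : G v
  isInit : IsInit v X
  subset : ∀ w, G w → IsInit w X → v ⊆ w

lemma IsFirst.unique {G : Finset ℕ → Prop} {v w : Finset ℕ} {X : Set ℕ} (hv : IsFirst G v X)
    (hw : IsFirst G w X) : v = w :=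
  (hv.subset w hw.prop hw.isInit).antisymm (hw.subset v hv.prop hv.isInit)

lemma exists_isFirst {G : Finset ℕ → Prop} {X : Set ℕ} (h : ∃ v, IsInit v X ∧ G v) :
    ∃ v, IsFirst G v X := by
  classical
  have h' : ∃ k, ∃ v : Finset ℕ, v.card = k ∧ IsInit v X ∧ G v := by
    obtain ⟨v, hv⟩ := h
    exact ⟨_, v, rfl, hv⟩
  obtain ⟨v, hvk, hv, hG⟩ := Nat.find_spec h'
  refine ⟨v, hG, hv, fun w hw hwX => ?_⟩
  rcases hv.subset_total hwX with h | h
  · exact h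
  · exact (Finset.eq_of_subset_of_card_le h (hvk ▸ Nat.find_min' h' ⟨w, rfl, hwX, hw⟩)).ge

lemma IsFirst.congr {G : Finset ℕ → Prop} {v : Finset ℕ} {X X' : Set ℕ} (hv : IsFirst G v X)
    (hX' : IsInit v X') : IsFirst G v X' := by
  refine ⟨hv.prop, hX', fun w hw hwX => ?_⟩
  rcases hX'.subset_total hwX with h | h
  · exact h
  · exact hv.subset w hw ((hwX.of_subset hX'.1 (by exact_mod_cast h)).trans hv.isInit)

/-- A family of non-empty finite sets that bars `Y` can be restricted to an infinite set on which
the shortest initial segments in the family do not shrink when the least element is deleted. -/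
lemma exists_not_isFirst_subset {G : Finset ℕ → Prop} {Y : Set ℕ} (hY : Y.Infinite)
    (hbar : ∀ X ⊆ Y, X.Infinite → ∃ v, IsInit v X ∧ G v) (hG : ¬ G ∅) :
    ∃ Z ⊆ Y, Z.Infinite ∧ ∀ X ⊆ Z, X.Infinite → ∀ v v', IsFirst G v X →
      IsFirst G v' (tailSet X) → ¬ v' ⊆ v := by
  have hfirst := fun X hX hi => exists_isFirst (hbar X hX hi)
  obtain ⟨Z, hZY, hZ, c, hc⟩ := exists_homogeneous hY
    (C := fun X => ∀ v v', IsFirst G v X → IsFirst G v' (tailSet X) → v' ⊆ v)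
    (fun X hX hi => by
      obtain ⟨v, hv⟩ := hfirst X hX hi
      obtain ⟨v', hv'⟩ := hfirst (tailSet X) ((tailSet_subset X).trans hX) (infinite_tailSet hi)
      -- The colour of `X` is read off from any initial segment covering both `v` and `v'`.
      obtain ⟨w, hw, hvw⟩ := exists_isInit_superset (F := v ∪ v') (X := X) (by
        rw [Finset.coe_union]
        exact Set.union_subset hv.isInit.1 (hv'.isInit.1.trans (tailSet_subset X)))
      rw [Finset.union_subset_iff] at hvw
      refine ⟨w, v' ⊆ v, hw, fun X' _ hwX' _ => propext ?_⟩
      have h := hv.congr (X' := X')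
        ((hv.isInit.of_subset hw.1 (by exact_mod_cast hvw.1)).trans hwX')
      have h' := hv'.congr (hv'.isInit.tailSet_congr hw hwX' hvw.2)
      refine ⟨fun H => H _ _ h h', fun H u u' hu hu' => ?_⟩
      rwa [hu.unique h, hu'.unique h'])
  refine ⟨Z, hZY, hZ, ?_⟩
  by_cases hcT : c
  -- If the shortest segments always shrank, iterated tails would keep them all inside the finite
  -- set `v`, although the elements of the `k`-th tail are at least `k`. Only `∅` would remain, and
  -- `hG` excludes it.
  · exfalso
    have htail : ∀ k, tailSet^[k] Z ⊆ Z ∧ (tailSet^[k] Z).Infinite ∧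
        ∀ x ∈ tailSet^[k] Z, k ≤ x := by
      intro k
      induction k with
      | zero => exact ⟨subset_rfl, hZ, fun x _ => Nat.zero_le x⟩
      | succ k ih =>
        rw [Function.iterate_succ_apply']
        refine ⟨(tailSet_subset _).trans ih.1, infinite_tailSet ih.2.1, ?_⟩
        rintro x ⟨_, m, hm, hmx⟩
        exact (ih.2.2 m hm).trans_lt hmx
    obtain ⟨v, hv⟩ := hfirst Z hZY hZ
    have hsub : ∀ k w, IsFirst G w (tailSet^[k] Z) → w ⊆ v := by
      intro k
      induction k with
      | zero => exact fun w hw => (hw.unique hv).le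
      | succ k ih =>
        intro w hw
        rw [Function.iterate_succ_apply'] at hw
        obtain ⟨w', hw'⟩ := hfirst _ ((htail k).1.trans hZY) (htail k).2.1
        exact ((hc _ (htail k).1 (htail k).2.1).2 hcT w' w hw' hw).trans (ih w' hw')
    obtain ⟨w, hw⟩ := hfirst _ ((htail (v.sup id + 1)).1.trans hZY) (htail (v.sup id + 1)).2.1
    rcases w.eq_empty_or_nonempty with rfl | ⟨x, hx⟩
    · exact hG hw.prop
    · have h1 := (htail (v.sup id + 1)).2.2 x (hw.isInit.1 hx)
      have h2 : x ≤ v.sup id := Finset.le_sup (f := id) (hsub _ w hw hx)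
      omega
  · intro X hX hi v v' hv hv' hvv'
    refine hcT ((hc X hX hi).1 fun u u' hu hu' => ?_)
    rwa [hu.unique hv, hu'.unique hv']

/-! ### Barriers and functions on them -/

lemma IsBarrier.infinite_base {B : Set (Finset ℕ)} (hB : IsBarrier B) : (base B).Infinite := by
  intro hf
  refine hB.infinite ((hf.toFinset.powerset.finite_toSet).subset fun s hs => ?_)
  rw [Finset.mem_coe, Finset.mem_powerset]
  intro x hx
  rw [Set.Finite.mem_toFinset]
  exact ⟨s, hs, hx⟩

lemma IsBarrier.nonempty_of_mem {B : Set (Finset ℕ)} (hB : IsBarrier B) {s : Finset ℕ}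
    (hs : s ∈ B) : s.Nonempty := by
  obtain ⟨t, ht, hne, _⟩ := hB.exists_init _ subset_rfl hB.infinite_base
  by_contra h
  rw [Finset.not_nonempty_iff_eq_empty] at h
  subst h
  exact hne (hB.antichain.eq hs ht (Finset.empty_subset t)).symm

lemma IsBarrier.restrict {B : Set (Finset ℕ)} (hB : IsBarrier B) {Z : Set ℕ}
    (hZ : Z ⊆ base B) (hi : Z.Infinite) : IsBarrier {s ∈ B | ↑s ⊆ Z} where
  infinite := by
    intro hf
    -- `hf.toFinset.sup id` is the union of the supposedly finitely many members; a member starting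
    -- beyond it is a new one.
    obtain ⟨s, hs, hne, hsX⟩ := hB.exists_init
      {x ∈ Z | Above (hf.toFinset.sup id) x} (fun x hx => hZ hx.1) (infinite_above hi _)
    obtain ⟨x, hx⟩ := Finset.nonempty_iff_ne_empty.2 hne
    have hmem : s ∈ hf.toFinset := by
      rw [Set.Finite.mem_toFinset]
      exact ⟨hs, fun y hy => (hsX.1 hy).1⟩
    exact lt_irrefl _ ((hsX.1 hx).2 x (Finset.le_sup (f := id) hmem hx))
  exists_init := by
    intro X hX hXi
    have hXZ : X ⊆ Z := fun x hx => by
      obtain ⟨s, hs, hxs⟩ := hX hx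
      exact hs.2 hxs
    obtain ⟨s, hs, hne, hsX⟩ := hB.exists_init X (hXZ.trans hZ) hXi
    exact ⟨s, ⟨hs, hsX.1.trans hXZ⟩, hne, hsX⟩
  antichain := hB.antichain.subset fun _ h => h.1

/-- Every map from a barrier, of whatever order type, to a better-quasi-order is good. -/
lemma IsBQO.isGood {Q : Type*} [LE Q] (h : IsBQO Q) {B : Set (Finset ℕ)} (hB : IsBarrier B)
    (f : ↥B → Q) : IsGood f := by
  obtain ⟨α, hα, hBα⟩ := hB.lexTypeLE
  exact h α hα B hB hBα f

/-- A map on a barrier induces a map on the infinite subsets of its base. -/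
lemma IsBarrier.exists_extend {B : Set (Finset ℕ)} (hB : IsBarrier B) {Q : Type*} (f : ↥B → Q) :
    ∃ φ : Set ℕ → Q, ∀ s : ↥B, ∀ X, IsInit s.1 X → φ X = f s := by
  classical
  obtain ⟨s₀, hs₀⟩ := hB.infinite.nonempty
  -- The value `f s₀` is a mere default for sets without an initial segment in `B`.
  refine ⟨fun X => if h : ∃ s : ↥B, IsInit s.1 X then f h.choose else f ⟨s₀, hs₀⟩,
    fun s X hs => ?_⟩
  have h : ∃ s : ↥B, IsInit s.1 X := ⟨s, hs⟩
  exact (dif_pos h).trans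
    (congrArg f (Subtype.ext (hB.eq_of_isInit h.choose.2 s.2 h.choose_spec hs)))

/-- With a limit at `∅`, the value of `φ` depends only on the least element. Since `p n` lies in the
limit, `p n ≤ p m` for all late `m`, and a set beginning with `n, m` violates badness. -/
lemma not_hasLimit_empty {φ : Set ℕ → P} {Y : Set ℕ} (hY : Y.Infinite)
    (hbad : ∀ X ⊆ Y, X.Infinite → ¬ φ X ≤ φ (tailSet X)) (I : Order.Ideal P) :
    ¬ HasLimit φ ∅ Y I := by
  intro h
  obtain ⟨p, hpI, hp, hlim⟩ := h.exists_eq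
  have habove : ∀ n, Above ∅ n := by simp [Above]
  obtain ⟨n, hn⟩ := hY.nonempty
  obtain ⟨N, hN⟩ := hlim _ (hpI n hn (habove n))
  obtain ⟨m, hm, hnm⟩ := hY.exists_gt (max n N)
  rw [max_lt_iff] at hnm
  have hT : (insert m {y ∈ Y | Above {m} y}).Infinite :=
    (infinite_above hY {m}).mono (Set.subset_insert _ _)
  have hnT : ∀ x ∈ insert m {y ∈ Y | Above {m} y}, n < x := by
    rintro x (rfl | hx)
    · exact hnm.1
    · exact hnm.1.trans (hx.2 m (by simp))
  have hTY : insert m {y ∈ Y | Above {m} y} ⊆ Y := Set.insert_subset hm fun y hy => hy.1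
  have htail := tailSet_insert hnT
  have hinit : ∀ k (W : Set ℕ), (∀ x ∈ W, k < x) → IsInit (insert k ∅) (insert k W) := by
    intro k W hW
    have := isInit_union (u := insert k ∅) (Z := W) fun z hz x hx => by
      rw [Finset.mem_singleton.1 hx]
      exact hW z hz
    rwa [insert_union_eq, Finset.coe_empty, Set.empty_union] at this
  refine hbad _ (Set.insert_subset hn hTY) (hT.mono (Set.subset_insert n _)) ?_
  rw [htail, hp _ (Set.insert_subset hn hTY) (hT.mono (Set.subset_insert n _)) n (habove n)
    (hinit n _ hnT), hp _ hTY hT m (habove m) (hinit m _ fun x hx => hx.2 m (by simp))]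
  exact hN m hm hnm.2 (habove m)

/-- An initial segment with a non-principal limit is shorter than one that determines `φ`. -/
lemma HasLimit.subset_of_const {φ : Set ℕ → P} {v s : Finset ℕ} {Y X : Set ℕ}
    {I : NonPrincipalIdeal P} (hY : Y.Infinite) (h : HasLimit φ v Y I.1) (hv : IsInit v X)
    (hvY : ↑v ⊆ Y) (hs : IsInit s X) {c : P} (hc : ∀ W, IsInit s W → φ W = c) : v ⊆ s := by
  by_contra hvs
  have hsv : IsInit s ↑v := hs.of_subset hv.1
    (by exact_mod_cast (hs.subset_total hv).resolve_right hvs)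
  obtain ⟨p, hpI, hp, hlim⟩ := h.exists_eq
  have hpc : ∀ n ∈ Y, Above v n → p n = c := by
    intro n hn hvn
    have hiv : IsInit v ↑(insert n v) := by
      rw [Finset.coe_insert, Set.insert_eq, Set.union_comm]
      exact isInit_union (by rintro z rfl; exact hvn)
    have hi := isInit_union (u := insert n v) (Z := {y ∈ Y | Above (insert n v) y})
      fun z hz => hz.2
    rw [← hp _ ?_ ((infinite_above hY _).mono Set.subset_union_right) n hvn hi]
    · exact hc _ (hsv.trans (hiv.trans hi))
    · refine Set.union_subset ?_ fun y hy => hy.1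
      rw [Finset.coe_insert]
      exact Set.insert_subset hn hvY
  -- All late values being `c`, the limit would be the principal ideal of `c`.
  refine I.2 c (le_antisymm (fun q hq => ?_) ?_)
  · obtain ⟨N, hN⟩ := hlim q hq
    obtain ⟨n, hn, hNn⟩ := (infinite_above hY v).exists_gt N
    exact Order.Ideal.mem_principal.2 ((hN n hn.1 hNn hn.2).trans_eq (hpc n hn.1 hn.2))
  · obtain ⟨n, hn⟩ := (infinite_above hY v).nonempty
    rw [Order.Ideal.principal_le_iff, ← hpc n hn.1 hn.2]
    exact hpI n hn.1 hn.2

/-- If the limits along `X` and along `X` without its least element are comparable, then so are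
two suitable values of `φ`. -/
lemma HasLimit.exists_le {φ : Set ℕ → P} {v v' : Finset ℕ} {X Y : Set ℕ} {I I' : Order.Ideal P}
    (h : HasLimit φ v Y I) (h' : HasLimit φ v' Y I') (hI : I ≤ I') (hX : X.Infinite)
    (hXY : X ⊆ Y) (hv : IsInit v X) (hv' : IsInit v' (tailSet X)) (hvv' : ¬ v' ⊆ v) :
    ∃ W ⊆ Y, W.Infinite ∧ φ W ≤ φ (tailSet W) := by
  obtain ⟨p, hpI, hp, -⟩ := h.exists_eq
  obtain ⟨p', -, hp', hlim⟩ := h'.exists_eq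
  obtain ⟨n, hnX, hvn, hnv, hmin⟩ := exists_next_of_infinite hX hv
  obtain ⟨N, hN⟩ := hlim _ (hI (hpI n (hXY hnX) hvn))
  obtain ⟨a, ha, hXa, hlt⟩ := exists_eq_insert hX.nonempty
  have hR : IsInit (insert a v') X := by
    refine ⟨?_, fun x hx y hy hxy => ?_⟩
    · rw [Finset.coe_insert]
      exact Set.insert_subset ha (hv'.1.trans (tailSet_subset X))
    · rw [hXa] at hx
      rcases hx with rfl | hx
      · simp
      · rcases Finset.mem_insert.1 hy with rfl | hy
        · exact absurd (hlt x hx) (by omega)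
        · exact Finset.mem_insert_of_mem (hv'.2 x hx y hy hxy)
  -- Since `v'` reaches beyond `v`, it reaches at least the next element `n`. So `φ` keeps the value
  -- `p n` when `X` is changed after `insert a v'`.
  have hnR : insert n v ⊆ insert a v' := by
    obtain ⟨y, hy, hyv⟩ := Finset.not_subset.1 hvv'
    have hyX : y ∈ X := (hv'.1 hy).1
    have hvy : Above v y := fun z hz => by
      by_contra! hyz
      exact hyv (hv.2 y hyX z hz hyz)
    intro x hx
    refine hR.2 x (hnv.1 hx) y (Finset.mem_insert_of_mem hy) ?_
    rcases Finset.mem_insert.1 hx with rfl | hx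
    · exact hmin y hyX hvy
    · exact (hvy x hx).le
  -- The new set continues `insert a v'` with `m`; beyond `N` the value `p' m` of its tail dominates
  -- `p n`.
  obtain ⟨m, hm, hNm⟩ := (infinite_above hX (insert a v')).exists_gt N
  have ham : a < m := hm.2 a (Finset.mem_insert_self _ _)
  set T := insert m {x ∈ X | Above (insert m v') x} with hT
  have hTi : T.Infinite := (infinite_above hX _).mono (Set.subset_insert _ _)
  have hTX : T ⊆ X := Set.insert_subset hm.1 fun x hx => hx.1
  have haT : ∀ x ∈ T, a < x := by
    rintro x (rfl | hx)
    · exact ham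
    · exact ham.trans (hx.2 m (Finset.mem_insert_self _ _))
  have hRT : ∀ x ∈ T, Above (insert a v') x := by
    intro x hx y hy
    rcases Finset.mem_insert.1 hy with rfl | hy
    · exact haT x hx
    · rcases hx with rfl | hx
      · exact hm.2 y (Finset.mem_insert_of_mem hy)
      · exact hx.2 y (Finset.mem_insert_of_mem hy)
  have hWX : ↑(insert a v') ∪ T ⊆ X := Set.union_subset hR.1 hTX
  have hWi : (↑(insert a v') ∪ T).Infinite := hTi.mono Set.subset_union_right
  have htail : tailSet (↑(insert a v') ∪ T) = ↑v' ∪ T := by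
    rw [insert_union_eq]
    refine tailSet_insert ?_
    rintro x (hx | hx)
    · exact hlt x (hv'.1 hx)
    · exact haT x hx
  refine ⟨_, hWX.trans hXY, hWi, ?_⟩
  rw [hp _ (hWX.trans hXY) hWi n hvn
    ((hnv.of_subset hR.1 (by exact_mod_cast hnR)).trans (isInit_union hRT)), htail,
    hp' _ ((Set.union_subset (hv'.1.trans (tailSet_subset X)) hTX).trans hXY)
      (hTi.mono Set.subset_union_right) m hm.2.of_insert ?_]
  · exact hN m (hXY hm.1) hNm hm.2.of_insert
  · have := isInit_union (u := insert m v') (Z := {x ∈ X | Above (insert m v') x})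
      fun z hz => hz.2
    rwa [insert_union_eq, ← Set.union_insert] at this

/-- On a well-quasi-order with better-quasi-ordered non-principal ideals, every map from a barrier
is good. -/
lemma isGood_of_isBQO_nonPrincipalIdeal [WellQuasiOrderedLE P]
    (hbqo : IsBQO (NonPrincipalIdeal P)) {B : Set (Finset ℕ)} (hB : IsBarrier B) (f : ↥B → P) :
    IsGood f := by
  by_contra hf
  obtain ⟨φ, hφ⟩ := hB.exists_extend f
  have hinit : ∀ X ⊆ base B, X.Infinite → ∃ s : ↥B, IsInit s.1 X := fun X hX hi => by
    obtain ⟨s, hs, _, hsX⟩ := hB.exists_init X hX hi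
    exact ⟨⟨s, hs⟩, hsX⟩
  have hshift : ∀ (s t : ↥B) (X : Set ℕ), X.Infinite → IsInit s.1 X → IsInit t.1 (tailSet X) →
      Shift s.1 t.1 := fun s t X hX hs ht =>
    hs.shift hX ht fun h => h.ne (hB.antichain.eq t.2 s.2 h.subset)
  have hbad : ∀ X ⊆ base B, X.Infinite → ¬ φ X ≤ φ (tailSet X) := by
    intro X hX hi hle
    obtain ⟨s, hs⟩ := hinit X hX hi
    obtain ⟨t, ht⟩ := hinit (tailSet X) ((tailSet_subset X).trans hX) (infinite_tailSet hi)
    rw [hφ s X hs, hφ t _ ht] at hle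
    exact hf ⟨s, t, hshift s t X hi hs ht, hle⟩
  obtain ⟨Y, hYB, hY, ⟨c, hc⟩ | hlim⟩ := exists_constOn_or_hasLimit hB.infinite_base (φ := φ)
    fun X hX hi => by
      obtain ⟨s, hs⟩ := hinit X hX hi
      exact ⟨s.1, f s, hs, fun W _ hW _ => hφ s W hW⟩
  · refine hbad Y hYB hY (le_of_eq ?_)
    rw [hc Y hY (isInit_empty Y) fun x hx _ => hx,
      hc _ (infinite_tailSet hY) (isInit_empty _) fun x hx _ => tailSet_subset Y hx]
  obtain ⟨Z, hZY, hZ, hshrink⟩ := exists_not_isFirst_subset hY hlim fun ⟨I, hI⟩ =>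
    not_hasLimit_empty hY (fun X hX => hbad X (hX.trans hYB)) I.1 hI
  have hZB := hZY.trans hYB
  have hBZ := hB.restrict hZB hZ
  have hext : ∀ s : Finset ℕ, ↑s ⊆ Z → ↑s ∪ {x ∈ Z | Above s x} ⊆ Z ∧
      (↑s ∪ {x ∈ Z | Above s x}).Infinite ∧ IsInit s (↑s ∪ {x ∈ Z | Above s x}) :=
    fun s hs => ⟨Set.union_subset hs fun x hx => hx.1,
      (infinite_above hZ s).mono Set.subset_union_right, isInit_union fun z hz => hz.2⟩
  -- Each `s` is completed by all larger elements of `Z`; the limit at the shortest segment of this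
  -- completion is the ideal assigned to `s`.
  have hv : ∀ s : ↥{s ∈ B | ↑s ⊆ Z}, ∃ v,
      IsFirst (fun v => ∃ I : NonPrincipalIdeal P, HasLimit φ v Y I.1) v
        (↑s.1 ∪ {x ∈ Z | Above s.1 x}) := fun s =>
    exists_isFirst (hlim _ ((hext s.1 s.2.2).1.trans hZY) (hext s.1 s.2.2).2.1)
  choose v hv using hv
  choose I hI using fun s => (hv s).prop
  obtain ⟨s, t, hst, hle⟩ := hbqo.isGood hBZ I
  obtain ⟨htZ, hti, htinit⟩ := hext t.1 t.2.2
  obtain ⟨n, hnt, hnZ, hsr, hsX⟩ := hst.exists_isInit (hB.nonempty_of_mem t.2.1)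
    (Z := {x ∈ Z | Above t.1 x}) fun z hz => hz.2
  have htail := tailSet_insert (n := n) (X := ↑t.1 ∪ {x ∈ Z | Above t.1 x}) (by
    rintro x (hx | hx)
    · exact hnt x hx
    · exact hnZ x hx)
  -- This places `n` in `Z`, so that the set joining `s` and `t` is a subset of `Z`.
  have hns : n ∈ s.1 := by
    obtain ⟨x, hx⟩ := hB.nonempty_of_mem s.2.1
    refine hsX.2 n (Set.mem_insert _ _) x hx ?_
    rcases Finset.mem_insert.1 (hsr hx) with rfl | hxt
    · exact le_rfl
    · exact (hnt x hxt).le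
  have hXZ := Set.insert_subset (s.2.2 hns) htZ
  have hXi := hti.mono (Set.subset_insert n _)
  -- Because `v s` lies within `s`, it is also the shortest segment for the set obtained from `s ◁
  -- t`, which continues `s` differently.
  have hvs : v s ⊆ s.1 := (hI s).subset_of_const hY (hv s).isInit
    ((hv s).isInit.1.trans ((hext s.1 s.2.2).1.trans hZY)) (hext s.1 s.2.2).2.2
    (hφ ⟨s.1, s.2.1⟩)
  have hvX := (hv s).congr (((hv s).isInit.of_subset (hext s.1 s.2.2).2.2.1
    (by exact_mod_cast hvs)).trans hsX)
  have hvt := hv t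
  rw [← htail] at hvt
  obtain ⟨W, hWY, hW, hWle⟩ := (hI s).exists_le (hI t) hle hXi (hXZ.trans hZY) hvX.isInit
    hvt.isInit (hshrink _ hXZ hXi _ _ hvX hvt)
  exact hbad W (hWY.trans hYB) hW hWle

end BQO

theorem corollary1p2 {P : Type*} [PartialOrder P]
    (hwqo : WellQuasiOrderedLE P) (hbqo : BQO.IsBQO (BQO.NonPrincipalIdeal P)) :
    BQO.IsBQO P := by
  intro _ _ B hB _ f
  exact BQO.isGood_of_isBQO_nonPrincipalIdeal hbqo hB f
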